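/- Let $(V,g)$ be a real vector space of finite even dimension $\dim V\ge 4$ with a positive definite inner product $g$. Let $$\mathcal T=\{K\in \mathrm{End}\,V \mid K^2=-\mathbb 1,\ g(K\cdot,K\cdot)=g(\cdot,\cdot)\},$$ regarded as a submanifold of $\mathrm{End}\,V$, so that $T_K\mathcal T=\{A\in\mathfrak o(V,g)\mid AK+KA=0\}$, where $\mathfrak o(V,g)$ is the space of $g$-skew endomorphisms. Let $\mathfrak{gl}(\mathbb V)=\mathrm{End}\,V\times\mathcal T$ and $\mathfrak o(\mathbb V,g)=\mathfrak o(V,g)\times\mathcal T$ be the trivial bundles over $\mathcal T$, and let $\phi$ be the tautological section $\phi|_K=K$. Write $[A,B]=AB-BA$ and $\{A,B\}=AB+BA$; write $\Gamma(\cdot)$ for smooth sections and $df_X$ for the derivative of $f$ along $X$. All conditions below are understood at each point $K\in\mathcal T$. A *skew algebroid* $(E,[\cdot,\cdot],\psi)$ on $\mathcal T$ is a smooth vector bundle $E\to\mathcal T$ with a skew-symmetric $\mathbb R$-bilinear bracket on $\Gamma(E)$ and a smooth bundle map $\psi:E\to T\mathcal T$ such that $\psi([A,B])=[\psi(A),\psi(B)]_{Lie}$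 and $[A,fB]=f[A,B]+\psi(A)[f]\,B$ for all $A,B\in\Gamma(E)$ and $f\in C^\infty(\mathcal T)$. Fix $J\in\mathcal T$, let $S\in\{\mathbb 1,\ J+\phi,\ J-\phi,\ [J,\phi]\}$, and let $E$ be one of $$\mathfrak o(\mathbb V,g),\quad \mathfrak o_{\{\phi\}}(\mathbb V)=\{A\in \mathfrak o(\mathbb V,g)\mid \{A,\phi\}=0\},\quad \mathfrak u(\mathbb V,J)=\{A\in \mathfrak o(\mathbb V,g)\mid [A,J]=0\},\quad \mathfrak u(\mathbb V,\phi)=\{A\in \mathfrak o(\mathbb V,g)\mid [A,\phi]=0\}.$$ For $\gamma\in\{\pm J,\pm\phi\}$ let $\tilde\gamma$ be the unique element of $\{\pm J,\pm\phi\}$ with $\gamma S=S\tilde\gamma$; it is also the unique one with $S\gamma=\tilde\gamma S$. If $E=\{A\in\mathfrak o(\mathbb V,g)\mid \gamma A=A\delta\}$ with $\gamma\in\{\pm J,\pm\phi\}$ and $\delta\in\{\gamma,-\gamma\}$, put $E^S=\{B\in\mathfrak o(\mathbb V,g)\mid\tilde\gamma B=B\tilde\delta\}$; if $E=\mathfrak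 o(\mathbb V,g)$, put $E^S=\mathfrak o(\mathbb V,g)$. **Theorem.** Let $k\geq 0$, let $a_0,\dots,a_k\in C^\infty(\mathcal T)$, let $$Q=a_k\{J,\phi\}^k+\dots+a_1\{J,\phi\}+a_0\mathbb 1,\qquad F=QS,$$ and suppose that $d(a_i)_{[SCS,\phi]}=0$ for all $i$ and all $C\in\Gamma(E^S)$. Let $\psi:E^S\to T\mathcal T$, $\psi(A)=[FAF,\phi]$. Then there is a skew bracket $[\cdot,\cdot]_F$ on $\Gamma(E^S)$ such that $(E^S,[\cdot,\cdot]_F,\psi)$ is a skew algebroid on $\mathcal T$. -/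

import Mathlib

open scoped ContDiff Topology InnerProductSpace

noncomputable section

namespace Twistor

variable (V : Type*) [NormedAddCommGroup V] [InnerProductSpace ℝ V]

/-- The twistor space of `V`: the orthogonal complex structures on `V`, as a subset of `End V`. -/
def twistorSet : Set (V →L[ℝ] V) :=
  {K | K * K = -1 ∧ ∀ x y : V, ⟪K x, K y⟫_ℝ = ⟪x, y⟫_ℝ}

/-- The twistor space as a type. -/
abbrev Tw : Type _ := ↥(twistorSet V)

/-- The Lie algebra `𝔬(V,g)` of skew endomorphisms. -/
def skewEnd : Submodule ℝ (V →L[ℝ] V) where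
  carrier := {A | ∀ x y : V, ⟪A x, y⟫_ℝ = -⟪x, A y⟫_ℝ}
  add_mem' := by
    intro A B hA hB x y
    simp only [Set.mem_ofPred_eq] at hA hB
    simp only [add_apply, inner_add_left, inner_add_right, hA x y, hB x y]
    ring
  zero_mem' := by intro x y; simp
  smul_mem' := by
    intro c A hA x y
    simp only [Set.mem_ofPred_eq] at hA
    simp only [smul_apply, inner_smul_left, inner_smul_right, hA x y]
    simp

variable {V}

/-- The tangent space `T_K 𝒯 = {A ∈ 𝔬(V,g) | AK + KA = 0}`, as a subspace of `End V`. -/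
def tangent (K : Tw V) : Submodule ℝ (V →L[ℝ] V) where
  carrier := {A | A ∈ skewEnd V ∧ A * K.1 + K.1 * A = 0}
  add_mem' := by
    rintro A B ⟨hA, hA'⟩ ⟨hB, hB'⟩
    refine ⟨add_mem hA hB, ?_⟩
    rw [add_mul, mul_add, add_add_add_comm, hA', hB', add_zero]
  zero_mem' := ⟨zero_mem _, by simp⟩
  smul_mem' := by
    rintro c A ⟨hA, hA'⟩
    refine ⟨Submodule.smul_mem _ c hA, ?_⟩
    rw [smul_mul_assoc, mul_smul_comm, ← smul_add, hA', smul_zero]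

section Calculus

variable {F : Type*} [NormedAddCommGroup F] [NormedSpace ℝ F]

/-- `f` is smooth near `K` on the submanifold `𝒯 ⊆ End V`: it is the restriction of a smooth map
defined on an open neighbourhood of `K` in `End V`. -/
def SmoothNear (f : Tw V → F) (K : Tw V) : Prop :=
  ∃ (U : Set (V →L[ℝ] V)) (g : (V →L[ℝ] V) → F), IsOpen U ∧ K.1 ∈ U ∧ ContDiffOn ℝ ∞ g U ∧
    ∀ L : Tw V, L.1 ∈ U → g L.1 = f L

/-- Smooth maps on `𝒯` with values in a normed space. -/
def IsSmooth (f : Tw V → F) : Prop := ∀ K, SmoothNear f K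

/-- The extension by zero of a map on `𝒯` to `End V`; only its values on `𝒯` are ever used. -/
def ext (f : Tw V → F) : (V →L[ℝ] V) → F := Function.extend Subtype.val f 0

/-- `df_X` at `K`, for `X ∈ T_K 𝒯`: the derivative within `𝒯` of `f`, applied to `X`.
(A derivative within `𝒯` is determined exactly on the tangent vectors to `𝒯`.) -/
def dd (f : Tw V → F) (K : Tw V) (X : V →L[ℝ] V) : F :=
  fderivWithin ℝ (ext f) (twistorSet V) K.1 X

theorem IsSmooth.add {f g : Tw V → F} (hf : IsSmooth f) (hg : IsSmooth g) :
    IsSmooth (f + g) := by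
  intro K
  obtain ⟨U, f', hU, hKU, hf', hff⟩ := hf K
  obtain ⟨W, g', hW, hKW, hg', hgg⟩ := hg K
  refine ⟨U ∩ W, fun x => f' x + g' x, hU.inter hW, ⟨hKU, hKW⟩,
    (hf'.mono Set.inter_subset_left).add (hg'.mono Set.inter_subset_right), ?_⟩
  intro L hL
  simp [hff L hL.1, hgg L hL.2]

theorem IsSmooth.smul {a : Tw V → ℝ} {f : Tw V → F} (ha : IsSmooth a) (hf : IsSmooth f) :
    IsSmooth (fun K => a K • f K) := by
  intro K
  obtain ⟨U, a', hU, hKU, ha', haa⟩ := ha K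
  obtain ⟨W, f', hW, hKW, hf', hff⟩ := hf K
  refine ⟨U ∩ W, fun x => a' x • f' x, hU.inter hW, ⟨hKU, hKW⟩,
    (ha'.mono Set.inter_subset_left).smul (hf'.mono Set.inter_subset_right), ?_⟩
  intro L hL
  simp [haa L hL.1, hff L hL.2]

theorem isSmooth_const (c : F) : IsSmooth (fun _ : Tw V => c) := fun _ =>
  ⟨Set.univ, fun _ => c, isOpen_univ, trivial, contDiffOn_const, fun _ _ => rfl⟩

end Calculus

/-- The family of subspaces `E K ⊆ End V` is a smooth vector subbundle of the trivial bundle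
`𝔤𝔩(𝕍) = End V × 𝒯`: near each point it has a smooth frame. -/
def IsSubbundle (E : Tw V → Submodule ℝ (V →L[ℝ] V)) : Prop :=
  ∀ K₀ : Tw V, ∃ (U : Set (Tw V)) (r : ℕ) (s : Fin r → Tw V → (V →L[ℝ] V)),
    IsOpen U ∧ K₀ ∈ U ∧ (∀ i, ∀ K ∈ U, SmoothNear (s i) K) ∧
    ∀ K ∈ U, LinearIndependent ℝ (fun i => s i K) ∧
      Submodule.span ℝ (Set.range fun i => s i K) = E K

/-- `Γ(E)`: the smooth sections of `E`. -/
def Gam (E : Tw V → Submodule ℝ (V →L[ℝ] V)) : Submodule ℝ (Tw V → (V →L[ℝ] V)) where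
  carrier := {A | IsSmooth A ∧ ∀ K, A K ∈ E K}
  add_mem' := by
    rintro A B ⟨hA, hA'⟩ ⟨hB, hB'⟩
    exact ⟨hA.add hB, fun K => add_mem (hA' K) (hB' K)⟩
  zero_mem' := ⟨isSmooth_const 0, fun K => zero_mem _⟩
  smul_mem' := by
    rintro c A ⟨hA, hA'⟩
    exact ⟨(isSmooth_const c).smul hA, fun K => Submodule.smul_mem _ c (hA' K)⟩

/-- The product `f A` of a section `A` by a smooth function `f`. -/
def mulSec {E : Tw V → Submodule ℝ (V →L[ℝ] V)} (f : Tw V → ℝ) (hf : IsSmooth f) (A : Gam E) :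
    Gam E :=
  ⟨fun K => f K • A.1 K, hf.smul A.2.1, fun K => Submodule.smul_mem _ _ (A.2.2 K)⟩

/-- The image `ψ(A)` of a section under a fibrewise map. -/
def pushSec (ψ : Tw V → (V →L[ℝ] V) →ₗ[ℝ] (V →L[ℝ] V)) (A : Tw V → (V →L[ℝ] V)) :
    Tw V → (V →L[ℝ] V) :=
  fun K => ψ K (A K)

/-- The Lie bracket of two vector fields on `𝒯`. -/
def lieBr (X Y : Tw V → (V →L[ℝ] V)) : Tw V → (V →L[ℝ] V) :=
  fun K => VectorField.lieBracketWithin ℝ (ext X) (ext Y) (twistorSet V) K.1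

/-- `(E, br, ψ)` is a skew algebroid on `𝒯`. Only the values of `ψ K` on `E K` matter. -/
structure IsSkewAlgebroid (E : Tw V → Submodule ℝ (V →L[ℝ] V))
    (br : Gam E →ₗ[ℝ] Gam E →ₗ[ℝ] Gam E)
    (ψ : Tw V → (V →L[ℝ] V) →ₗ[ℝ] (V →L[ℝ] V)) : Prop where
  /-- `E` is a smooth vector bundle. -/
  subbundle : IsSubbundle E
  /-- `ψ` maps `E` to the tangent bundle of `𝒯`. -/
  anchor_mem : ∀ K, ∀ A ∈ E K, ψ K A ∈ tangent K
  /-- `ψ` is a smooth bundle map. -/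
  anchor_smooth : ∀ A : Gam E, IsSmooth (pushSec ψ A.1)
  skew : ∀ A B : Gam E, br A B = -br B A
  anchor_bracket : ∀ A B : Gam E,
    pushSec ψ (br A B).1 = lieBr (pushSec ψ A.1) (pushSec ψ B.1)
  leibniz : ∀ (A B : Gam E) (f : Tw V → ℝ) (hf : IsSmooth f) (K : Tw V),
    (br A (mulSec f hf B)).1 K =
      f K • (br A B).1 K + dd f K (ψ K (A.1 K)) • B.1 K

/-- The four choices `𝟙`, `J + φ`, `J - φ`, `[J, φ]` for `S`. -/
inductive SType
  | one | plus | minus | comm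

/-- The section `S` of `𝔤𝔩(𝕍)`; here `φ` is the tautological section, `φ|_K = K`. -/
def SType.sec (S : SType) (J : Tw V) (K : Tw V) : V →L[ℝ] V :=
  match S with
  | .one => 1
  | .plus => J.1 + K.1
  | .minus => J.1 - K.1
  | .comm => J.1 * K.1 - K.1 * J.1

/-- The set `{±J, ±φ}`. -/
inductive Gen
  | posJ | negJ | posPhi | negPhi

/-- An element of `{±J, ±φ}` as a section of `𝔤𝔩(𝕍)`. -/
def Gen.sec (γ : Gen) (J : Tw V) (K : Tw V) : V →L[ℝ] V :=
  match γ with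
  | .posJ => J.1
  | .negJ => -J.1
  | .posPhi => K.1
  | .negPhi => -K.1

/-- `γ ↦ γ̃`, where `γ̃` is the unique element of `{±J, ±φ}` with `γ S = S γ̃`, equivalently with
`S γ = γ̃ S`; see `Gen.tilde_left_iff` and `Gen.tilde_right_iff`. -/
def Gen.tilde : SType → Gen → Gen
  | .one, γ => γ
  | .plus, .posJ => .posPhi
  | .plus, .negJ => .negPhi
  | .plus, .posPhi => .posJ
  | .plus, .negPhi => .negJ
  | .minus, .posJ => .negPhi
  | .minus, .negJ => .posPhi
  | .minus, .posPhi => .negJ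
  | .minus, .negPhi => .posJ
  | .comm, .posJ => .negJ
  | .comm, .negJ => .posJ
  | .comm, .posPhi => .negPhi
  | .comm, .negPhi => .posPhi

theorem sq_apply (K : Tw V) (x : V) : K.1 (K.1 x) = -x := by
  simpa using congrArg (fun A : V →L[ℝ] V => A x) K.2.1

theorem Gen.mul_S (S : SType) (γ : Gen) (J K : Tw V) :
    γ.sec J K * S.sec J K = S.sec J K * (γ.tilde S).sec J K := by
  ext x
  cases S <;> cases γ <;> simp [Gen.sec, SType.sec, Gen.tilde, sq_apply] <;> abel

theorem Gen.S_mul (S : SType) (γ : Gen) (J K : Tw V) :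
    S.sec J K * γ.sec J K = (γ.tilde S).sec J K * S.sec J K := by
  ext x
  cases S <;> cases γ <;> simp [Gen.sec, SType.sec, Gen.tilde, sq_apply] <;> abel

theorem inner_J (J : Tw V) (x y : V) : ⟪J.1 x, y⟫_ℝ = -⟪x, J.1 y⟫_ℝ := by
  rw [← J.2.2 x (J.1 y), sq_apply, inner_neg_right, neg_neg]

theorem inner_J_self (J : Tw V) (x : V) : ⟪x, J.1 x⟫_ℝ = 0 := by
  have h := inner_J J x x
  rw [real_inner_comm] at h
  linarith

theorem norm_J (J : Tw V) (x : V) : ‖J.1 x‖ = ‖x‖ := by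
  have h := J.2.2 x x
  rw [real_inner_self_eq_norm_sq, real_inner_self_eq_norm_sq] at h
  exact (sq_eq_sq₀ (norm_nonneg _) (norm_nonneg _)).1 h

/-- In dimension at least four there is a `K` that anticommutes with `J` on a nonzero vector. -/
theorem exists_anticomm [FiniteDimensional ℝ V] (h4 : 4 ≤ Module.finrank ℝ V) (J : Tw V) :
    ∃ (K : Tw V) (e : V), e ≠ 0 ∧ K.1 (J.1 e) = -J.1 (K.1 e) := by
  classical
  have : Nontrivial V := Module.nontrivial_of_finrank_pos (R := ℝ) (by omega)
  obtain ⟨e, he⟩ := exists_norm_eq V (zero_le_one' ℝ)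
  let P : Submodule ℝ V := Submodule.span ℝ (({e, J.1 e} : Finset V) : Set V)
  have hP : Module.finrank ℝ P ≤ 2 :=
    (finrank_span_finset_le_card ({e, J.1 e} : Finset V)).trans Finset.card_le_two
  have hP' : 0 < Module.finrank ℝ Pᗮ := by
    have := P.finrank_add_finrank_orthogonal
    omega
  have : Nontrivial Pᗮ := Module.nontrivial_of_finrank_pos hP'
  obtain ⟨⟨f, hfP⟩, hf⟩ := exists_norm_eq Pᗮ (zero_le_one' ℝ)
  have hf : ‖f‖ = 1 := hf
  have hee : ⟪e, e⟫_ℝ = 1 := by rw [real_inner_self_eq_norm_sq, he]; norm_num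
  have hff : ⟪f, f⟫_ℝ = 1 := by rw [real_inner_self_eq_norm_sq, hf]; norm_num
  have hef : ⟪e, f⟫_ℝ = 0 :=
    (Submodule.mem_orthogonal P f).1 hfP e (Submodule.subset_span (by simp))
  have hJef : ⟪J.1 e, f⟫_ℝ = 0 :=
    (Submodule.mem_orthogonal P f).1 hfP (J.1 e) (Submodule.subset_span (by simp))
  have heJf : ⟪e, J.1 f⟫_ℝ = 0 := by
    have := inner_J J e f
    linarith
  have hfe : ⟪f, e⟫_ℝ = 0 := by rw [real_inner_comm]; exact hef
  have hfJe : ⟪f, J.1 e⟫_ℝ = 0 := by rw [real_inner_comm]; exact hJef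
  have hJfe : ⟪J.1 f, e⟫_ℝ = 0 := by rw [real_inner_comm]; exact heJf
  have heJe := inner_J_self J e
  have hfJf := inner_J_self J f
  have hJee : ⟪J.1 e, e⟫_ℝ = 0 := by rw [real_inner_comm]; exact heJe
  have hJff : ⟪J.1 f, f⟫_ℝ = 0 := by rw [real_inner_comm]; exact hfJf
  let ι : V → (V →L[ℝ] ℝ) := fun v => innerSL ℝ v
  let K : V →L[ℝ] V := J.1
    - ((ι e).smulRight (J.1 e) - (ι (J.1 e)).smulRight e
      + (ι f).smulRight (J.1 f) - (ι (J.1 f)).smulRight f)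
    + ((ι e).smulRight f - (ι f).smulRight e
      - (ι (J.1 e)).smulRight (J.1 f) + (ι (J.1 f)).smulRight (J.1 e))
  have hK : ∀ x, K x = J.1 x
      - (⟪e, x⟫_ℝ • J.1 e - ⟪J.1 e, x⟫_ℝ • e + ⟪f, x⟫_ℝ • J.1 f - ⟪J.1 f, x⟫_ℝ • f)
      + (⟪e, x⟫_ℝ • f - ⟪f, x⟫_ℝ • e - ⟪J.1 e, x⟫_ℝ • J.1 f + ⟪J.1 f, x⟫_ℝ • J.1 e) := by
    intro x
    simp [K, ι]
  have hKe : K e = f := by simp [hK, he, hfe, hJee, hJfe]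
  have hKf : K f = -e := by simp [hK, hf, hef, hJef, hJff]
  have hKJe : K (J.1 e) = -J.1 f := by
    simp [hK, heJe, hfJe, J.2.2, norm_J, he, hfe, sq_apply]
  have hKJf : K (J.1 f) = J.1 e := by
    simp [hK, heJf, hfJf, J.2.2, norm_J, hf, hef, sq_apply]
  have hsq : K * K = -1 := by
    ext x
    rw [mul_apply_eq_comp]
    conv_lhs => rw [hK x]
    simp only [map_add, map_sub, map_smul, hKe, hKf, hKJe, hKJf]
    rw [hK (J.1 x)]
    have h1 : ⟪e, J.1 x⟫_ℝ = -⟪J.1 e, x⟫_ℝ := by rw [inner_J, neg_neg]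
    have h2 : ⟪f, J.1 x⟫_ℝ = -⟪J.1 f, x⟫_ℝ := by rw [inner_J, neg_neg]
    simp only [sq_apply, J.2.2, h1, h2, neg_apply,
      one_apply_eq_self]
    module
  have hskew : ∀ x y, ⟪K x, y⟫_ℝ = -⟪x, K y⟫_ℝ := by
    intro x y
    simp only [hK, inner_add_left, inner_add_right, inner_sub_left, inner_sub_right,
      real_inner_smul_left, real_inner_smul_right, inner_J J x y]
    simp only [real_inner_comm x]
    ring
  refine ⟨⟨K, hsq, ?_⟩, e, ?_, ?_⟩
  · intro x y
    have h : K (K y) = -y := by simpa using congrArg (fun A : V →L[ℝ] V => A y) hsq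
    rw [hskew, h, inner_neg_right, neg_neg]
  · rintro rfl
    simp at he
  · change K (J.1 e) = -J.1 (K e)
    rw [hKJe, hKe]

theorem anticomm_mul {J K : Tw V} {v : V} (hv : K.1 (J.1 v) = -J.1 (K.1 v)) :
    K.1 (J.1 (K.1 v)) = J.1 v := by
  rw [← neg_eq_iff_eq_neg.2 hv, map_neg, sq_apply, neg_neg]

theorem anticomm_gen {J K : Tw V} {v : V} (hv : K.1 (J.1 v) = -J.1 (K.1 v)) (γ : Gen) :
    K.1 (J.1 (γ.sec J K v)) = -J.1 (K.1 (γ.sec J K v)) := by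
  cases γ <;> simp [Gen.sec, hv, anticomm_mul hv, sq_apply]

theorem anticomm_S {J K : Tw V} {v : V} (hv : K.1 (J.1 v) = -J.1 (K.1 v)) (S : SType) :
    K.1 (J.1 (S.sec J K v)) = -J.1 (K.1 (S.sec J K v)) := by
  cases S <;> simp [SType.sec, hv, anticomm_mul hv, sq_apply] <;> abel

theorem S_S_apply {J K : Tw V} {v : V} (hv : K.1 (J.1 v) = -J.1 (K.1 v)) (S : SType) :
    ∃ c : ℝ, c ≠ 0 ∧ ∀ γ : Gen, S.sec J K (S.sec J K (γ.sec J K v)) = c • γ.sec J K v := by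
  have key : ∃ c : ℝ, c ≠ 0 ∧ ∀ w, K.1 (J.1 w) = -J.1 (K.1 w) →
      S.sec J K (S.sec J K w) = c • w := by
    cases S
    · exact ⟨1, one_ne_zero, fun w _ => by simp [SType.sec]⟩
    · refine ⟨-2, by norm_num, fun w hw => ?_⟩
      simp [SType.sec, hw, sq_apply]; module
    · refine ⟨-2, by norm_num, fun w hw => ?_⟩
      simp [SType.sec, hw, sq_apply]; module
    · refine ⟨-4, by norm_num, fun w hw => ?_⟩
      simp [SType.sec, hw, anticomm_mul hw, sq_apply]; module
  obtain ⟨c, hc, h⟩ := key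
  exact ⟨c, hc, fun γ => h _ (anticomm_gen hv γ)⟩

theorem gen_inj {J K : Tw V} {v : V} (hv0 : v ≠ 0) (hv : K.1 (J.1 v) = -J.1 (K.1 v))
    {γ γ' : Gen} (h : γ.sec J K v = γ'.sec J K v) : γ = γ' := by
  have hne : ⟪v, v⟫_ℝ ≠ 0 := inner_self_ne_zero.2 hv0
  have hJK : ⟪J.1 v, K.1 v⟫_ℝ = 0 := by
    have h1 := inner_J J v (K.1 v)
    have h2 := inner_J K v (J.1 v)
    rw [hv, inner_neg_right, neg_neg, real_inner_comm] at h2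
    linarith
  have hKJ : ⟪K.1 v, J.1 v⟫_ℝ = 0 := by rw [real_inner_comm]; exact hJK
  have hJ := congrArg (fun w => ⟪J.1 v, w⟫_ℝ) h
  have hK := congrArg (fun w => ⟪K.1 v, w⟫_ℝ) h
  cases γ <;> cases γ' <;> first
    | rfl
    | (exfalso
       simp only [Gen.sec, neg_apply, inner_neg_right, J.2.2, K.2.2, hJK,
         hKJ] at hJ hK
       apply hne
       linarith)

/-- `γ̃` is the unique element of `{±J, ±φ}` with `γ S = S γ̃`. -/
theorem Gen.tilde_left_iff [FiniteDimensional ℝ V] (h4 : 4 ≤ Module.finrank ℝ V) (J : Tw V)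
    (S : SType) (γ γ' : Gen) :
    (∀ K : Tw V, γ.sec J K * S.sec J K = S.sec J K * γ'.sec J K) ↔ γ' = γ.tilde S := by
  refine ⟨fun h => ?_, fun h K => h ▸ Gen.mul_S S γ J K⟩
  obtain ⟨K, e, he, hKe⟩ := exists_anticomm h4 J
  obtain ⟨c, hc, hS⟩ := S_S_apply hKe S
  have h1 := congrArg (fun A : V →L[ℝ] V => S.sec J K (A e))
    ((h K).symm.trans (Gen.mul_S S γ J K))
  simp only [mul_apply_eq_comp, hS] at h1
  exact gen_inj he hKe (smul_right_injective V hc h1)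

/-- `γ̃` is the unique element of `{±J, ±φ}` with `S γ = γ̃ S`. -/
theorem Gen.tilde_right_iff [FiniteDimensional ℝ V] (h4 : 4 ≤ Module.finrank ℝ V) (J : Tw V)
    (S : SType) (γ γ' : Gen) :
    (∀ K : Tw V, S.sec J K * γ.sec J K = γ'.sec J K * S.sec J K) ↔ γ' = γ.tilde S := by
  refine ⟨fun h => ?_, fun h K => h ▸ Gen.S_mul S γ J K⟩
  obtain ⟨K, e, he, hKe⟩ := exists_anticomm h4 J
  have h1 := congrArg (fun A : V →L[ℝ] V => A e) ((h K).symm.trans (Gen.S_mul S γ J K))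
  refine gen_inj ?_ (anticomm_S hKe S) h1
  intro h0
  obtain ⟨c, hc, hS⟩ := S_S_apply hKe S
  have h2 := hS .posJ
  rw [← mul_apply_eq_comp, ← mul_apply_eq_comp, mul_assoc, Gen.S_mul,
    ← mul_assoc, Gen.S_mul, mul_assoc, mul_apply_eq_comp,
    mul_apply_eq_comp, h0, map_zero, map_zero] at h2
  have h3 : J.1 e = 0 := (smul_eq_zero.1 h2.symm).resolve_left hc
  apply he
  have h4 := sq_apply J e
  rw [h3, map_zero] at h4
  simpa using h4.symm

/-- The bundle `{A ∈ 𝔬(𝕍,g) | γ A = A δ}`. -/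
def genBundle (J : Tw V) (γ δ : Gen) (K : Tw V) : Submodule ℝ (V →L[ℝ] V) where
  carrier := {A | A ∈ skewEnd V ∧ γ.sec J K * A = A * δ.sec J K}
  add_mem' := by
    rintro A B ⟨hA, hA'⟩ ⟨hB, hB'⟩
    exact ⟨add_mem hA hB, by rw [mul_add, add_mul, hA', hB']⟩
  zero_mem' := ⟨zero_mem _, by simp⟩
  smul_mem' := by
    rintro c A ⟨hA, hA'⟩
    exact ⟨Submodule.smul_mem _ c hA, by rw [mul_smul_comm, smul_mul_assoc, hA']⟩

/-- The four choices `𝔬(𝕍,g)`, `𝔬_{φ}(𝕍)`, `𝔲(𝕍,J)`, `𝔲(𝕍,φ)` for `E`. -/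
inductive EType
  | o | oPhi | uJ | uPhi

/-- The bundle `E`: `𝔬_{φ} = {φA = A(-φ)}`, `𝔲(J) = {JA = AJ}`, `𝔲(φ) = {φA = Aφ}`. -/
def EType.bundle (E : EType) (J : Tw V) (K : Tw V) : Submodule ℝ (V →L[ℝ] V) :=
  match E with
  | .o => skewEnd V
  | .oPhi => genBundle J .posPhi .negPhi K
  | .uJ => genBundle J .posJ .posJ K
  | .uPhi => genBundle J .posPhi .posPhi K

/-- The bundle `E^S`: if `E = {A ∈ 𝔬(𝕍,g) | γ A = A δ}` then
`E^S = {B ∈ 𝔬(𝕍,g) | γ̃ B = B δ̃}`, and `𝔬(𝕍,g)^S = 𝔬(𝕍,g)`. -/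
def EType.bundleS (E : EType) (S : SType) (J : Tw V) (K : Tw V) : Submodule ℝ (V →L[ℝ] V) :=
  match E with
  | .o => skewEnd V
  | .oPhi => genBundle J (Gen.posPhi.tilde S) (Gen.negPhi.tilde S) K
  | .uJ => genBundle J (Gen.posJ.tilde S) (Gen.posJ.tilde S) K
  | .uPhi => genBundle J (Gen.posPhi.tilde S) (Gen.posPhi.tilde S) K

/-- `Q = a_k {J,φ}^k + ⋯ + a_1 {J,φ} + a_0 𝟙`. -/
def polyQ (J : Tw V) {k : ℕ} (a : Fin (k + 1) → Tw V → ℝ) (K : Tw V) : V →L[ℝ] V :=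
  ∑ i : Fin (k + 1), a i K • (J.1 * K.1 + K.1 * J.1) ^ (i : ℕ)

/-- The fibrewise map `A ↦ [F A F, φ]`. -/
def anchor (F : Tw V → (V →L[ℝ] V)) (K : Tw V) : (V →L[ℝ] V) →ₗ[ℝ] (V →L[ℝ] V) where
  toFun A := F K * A * F K * K.1 - K.1 * (F K * A * F K)
  map_add' A B := by simp only [mul_add, add_mul]; abel
  map_smul' c A := by
    simp only [mul_smul_comm, smul_mul_assoc, RingHom.id_apply, smul_sub]

end Twistor

end

/-!
The anchor `C ↦ [C, φ]` makes `𝔬(𝕍,g)` an action algebroid, whose bracket we pull back along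
`A ↦ F A F`. Both `J` and `φ` can be moved past `F`, and the `a_i` are constant along the anchor, so
the derivative of `F` along `ψ(A)` has the form `F D(A) F`; hence the derivative of `F B F` along
`ψ(A)` is again of the form `F (⋯) F`, and so is the action bracket of `F A F` and `F B F`.
It remains to project to `E^S`. Under `A ↦ F A F` the projection to `E^S` corresponds to the
projection `P₀` to `E`, and `[P₀ X, φ] = [X, φ]` when `X` is an action bracket of sections of `E`,
so that the anchor of the bracket is not affected.
-/

noncomputable section

namespace Twistor

section Algebra

variable {V : Type*} [NormedAddCommGroup V] [InnerProductSpace ℝ V]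

theorem Tw.mul_self (K : Tw V) : K.1 * K.1 = -1 := K.2.1

theorem Tw.mul_self_mul (K : Tw V) (A : V →L[ℝ] V) : K.1 * (K.1 * A) = -A := by
  rw [← mul_assoc, K.mul_self, neg_one_mul]

variable [CompleteSpace V]

theorem mem_skewEnd_iff {A : V →L[ℝ] V} : A ∈ skewEnd V ↔ star A = -A := by
  rw [ContinuousLinearMap.star_eq_adjoint, eq_comm, ContinuousLinearMap.eq_adjoint_iff]
  exact forall₂_congr fun x y => by rw [neg_apply, inner_neg_left, neg_eq_iff_eq_neg]

theorem Tw.star_eq (K : Tw V) : star K.1 = -K.1 := mem_skewEnd_iff.1 (inner_J K)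

theorem mem_twistorSet_iff {A : V →L[ℝ] V} :
    A ∈ twistorSet V ↔ A * A = -1 ∧ star A = -A := by
  refine ⟨fun h => ⟨h.1, Tw.star_eq ⟨A, h⟩⟩, fun ⟨hsq, hstar⟩ => ⟨hsq, fun x y => ?_⟩⟩
  rw [mem_skewEnd_iff.2 hstar x (A y), ← mul_apply_eq_comp, hsq, neg_apply, one_apply_eq_self,
    inner_neg_right, neg_neg]

theorem lie_mem_skewEnd {A B : V →L[ℝ] V} (hA : A ∈ skewEnd V) (hB : B ∈ skewEnd V) :
    ⁅A, B⁆ ∈ skewEnd V := by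
  rw [mem_skewEnd_iff] at *
  rw [Ring.lie_def, star_sub, star_mul, star_mul, hA, hB]
  noncomm_ring

theorem lie_mem_tangent {C : V →L[ℝ] V} (hC : C ∈ skewEnd V) (K : Tw V) :
    ⁅C, K.1⁆ ∈ tangent K := by
  refine ⟨lie_mem_skewEnd hC (inner_J K), ?_⟩
  simp only [Ring.lie_def, sub_mul, mul_sub, mul_assoc, K.mul_self, K.mul_self_mul]
  noncomm_ring

theorem exists_lie_eq_of_mem_tangent {K : Tw V} {X : V →L[ℝ] V} (hX : X ∈ tangent K) :
    ∃ C ∈ skewEnd V, ⁅C, K.1⁆ = X := by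
  obtain ⟨hXskew, hanti⟩ := hX
  have hXK : X * K.1 = -(K.1 * X) := eq_neg_of_add_eq_zero_left hanti
  refine ⟨(1 / 2 : ℝ) • (K.1 * X), mem_skewEnd_iff.2 ?_, ?_⟩
  · rw [star_smul, star_mul, K.star_eq, mem_skewEnd_iff.1 hXskew, neg_mul_neg, hXK, star_trivial,
      smul_neg]
  · rw [Ring.lie_def, smul_mul_assoc, mul_smul_comm, mul_assoc, hXK, mul_neg, K.mul_self_mul]
    module

theorem conj_mem_twistorSet {U A : V →L[ℝ] V} (hU : U ∈ unitary (V →L[ℝ] V))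
    (hA : A ∈ twistorSet V) : U * A * star U ∈ twistorSet V := by
  rw [mem_twistorSet_iff] at *
  constructor
  · calc U * A * star U * (U * A * star U) = U * A * (star U * U) * A * star U := by
          noncomm_ring
      _ = U * (A * A) * star U := by rw [Unitary.star_mul_self_of_mem hU, mul_one, mul_assoc U]
      _ = -1 := by rw [hA.1, mul_neg_one, neg_mul, Unitary.mul_star_self_of_mem hU]
  · rw [star_mul, star_mul, star_star, hA.2, neg_mul, mul_neg, mul_assoc]

theorem hasDerivAt_exp_conj (C A : V →L[ℝ] V) (hC : C ∈ skewEnd V) :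
    HasDerivAt (fun t : ℝ => NormedSpace.exp (t • C) * A * star (NormedSpace.exp (t • C)))
      ⁅C, A⁆ 0 := by
  have hexp : HasDerivAt (fun t : ℝ => NormedSpace.exp (t • C)) C 0 := by
    simpa using hasDerivAt_exp_smul_const (𝕂 := ℝ) C 0
  refine ((hexp.mul_const A).mul hexp.star).congr_deriv ?_
  simp [Ring.lie_def, mem_skewEnd_iff.1 hC, sub_eq_add_neg]

theorem exp_smul_mem_unitary {C : V →L[ℝ] V} (hC : C ∈ skewEnd V) (t : ℝ) :
    NormedSpace.exp (t • C) ∈ unitary (V →L[ℝ] V) := by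
  let _ : NormedAlgebra ℚ (V →L[ℝ] V) := NormedAlgebra.restrictScalars ℚ ℝ _
  refine NormedSpace.exp_mem_unitary_of_mem_skewAdjoint ?_
  exact mem_skewEnd_iff.1 (Submodule.smul_mem _ t hC)

theorem mem_tangentConeAt_of_hasDerivAt {W : Type*} [NormedAddCommGroup W] [NormedSpace ℝ W]
    {s : Set W} {c : ℝ → W} {v : W} {t : ℝ} (hc : HasDerivAt c v t) (hs : ∀ t, c t ∈ s) :
    v ∈ tangentConeAt ℝ s (c t) := by
  have hrange := hc.hasFDerivAt.hasFDerivWithinAt.mapsTo_tangent_cone (s := Set.univ)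
    (show (1 : ℝ) ∈ _ by rw [tangentConeAt_univ]; trivial)
  have hsub : c '' Set.univ ⊆ s := by
    rintro _ ⟨t, -, rfl⟩
    exact hs t
  simpa using tangentConeAt_mono hsub hrange

/-- The curve `t ↦ exp(tC) K exp(-tC)` stays in `𝒯` and has velocity `[C, K]`. -/
theorem tangent_subset_tangentConeAt (K : Tw V) :
    (tangent K : Set (V →L[ℝ] V)) ⊆ tangentConeAt ℝ (twistorSet V) K.1 := by
  intro X hX
  obtain ⟨C, hC, rfl⟩ := exists_lie_eq_of_mem_tangent hX
  simpa using mem_tangentConeAt_of_hasDerivAt (hasDerivAt_exp_conj C K.1 hC)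
    fun t => conj_mem_twistorSet (exp_smul_mem_unitary hC t) K.2

end Algebra

section Calculus

variable {V : Type*} [NormedAddCommGroup V] [InnerProductSpace ℝ V]
variable {F G H : Type*} [NormedAddCommGroup F]

theorem ext_apply (f : Tw V → F) (K : Tw V) : ext f K.1 = f K :=
  Subtype.val_injective.extend_apply f 0 K

theorem ext_of_mem (f : Tw V → F) {L : V →L[ℝ] V} (hL : L ∈ twistorSet V) :
    ext f L = f ⟨L, hL⟩ :=
  ext_apply f ⟨L, hL⟩

variable [NormedSpace ℝ F] [NormedAddCommGroup G] [NormedSpace ℝ G]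
  [NormedAddCommGroup H] [NormedSpace ℝ H]

theorem hasFDerivWithinAt_ext {f : Tw V → F} {g : (V →L[ℝ] V) → F} {U : Set (V →L[ℝ] V)}
    {K : Tw V} (hU : IsOpen U) (hK : K.1 ∈ U) (hg : ContDiffOn ℝ ∞ g U)
    (hfg : ∀ L : Tw V, L.1 ∈ U → g L.1 = f L) :
    HasFDerivWithinAt (ext f) (fderiv ℝ g K.1) (twistorSet V) K.1 := by
  have hg' : HasFDerivWithinAt g (fderiv ℝ g K.1) (twistorSet V) K.1 :=
    ((hg.contDiffAt (hU.mem_nhds hK)).differentiableAt (by simp)).hasFDerivAt.hasFDerivWithinAt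
  refine hg'.congr_of_eventuallyEq ?_ (by rw [ext_apply, hfg K hK])
  filter_upwards [self_mem_nhdsWithin, mem_nhdsWithin_of_mem_nhds (hU.mem_nhds hK)] with L hL hLU
  rw [hfg ⟨L, hL⟩ hLU, ext_of_mem f hL]

theorem IsSmooth.hasFDerivWithinAt {f : Tw V → F} (hf : IsSmooth f) (K : Tw V) :
    HasFDerivWithinAt (ext f) (fderivWithin ℝ (ext f) (twistorSet V) K.1) (twistorSet V) K.1 := by
  obtain ⟨U, g, hU, hK, hg, hfg⟩ := hf K
  exact (hasFDerivWithinAt_ext hU hK hg hfg).differentiableWithinAt.hasFDerivWithinAt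

theorem isSmooth_val : IsSmooth (fun K : Tw V => K.1) := fun _ =>
  ⟨Set.univ, id, isOpen_univ, trivial, contDiffOn_id, fun _ _ => rfl⟩

theorem IsSmooth.clm_comp {f : Tw V → F} (hf : IsSmooth f) (T : F →L[ℝ] G) :
    IsSmooth (fun K => T (f K)) := by
  intro K
  obtain ⟨U, g, hU, hK, hg, hfg⟩ := hf K
  exact ⟨U, fun x => T (g x), hU, hK, T.contDiff.comp_contDiffOn hg,
    fun L hL => by simp only [hfg L hL]⟩

theorem IsSmooth.clm_apply {f : Tw V → F →L[ℝ] G} {g : Tw V → F} (hf : IsSmooth f)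
    (hg : IsSmooth g) : IsSmooth (fun K => f K (g K)) := by
  intro K
  obtain ⟨U, f', hU, hKU, hf', hff⟩ := hf K
  obtain ⟨W, g', hW, hKW, hg', hgg⟩ := hg K
  exact ⟨U ∩ W, fun x => f' x (g' x), hU.inter hW, ⟨hKU, hKW⟩,
    (hf'.mono Set.inter_subset_left).clm_apply (hg'.mono Set.inter_subset_right),
    fun L hL => by simp only [hff L hL.1, hgg L hL.2]⟩

theorem IsSmooth.bilin (T : F →L[ℝ] G →L[ℝ] H) {f : Tw V → F} {g : Tw V → G}
    (hf : IsSmooth f) (hg : IsSmooth g) : IsSmooth (fun K => T (f K) (g K)) :=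
  (hf.clm_comp T).clm_apply hg

theorem IsSmooth.mul {f g : Tw V → (F →L[ℝ] F)} (hf : IsSmooth f) (hg : IsSmooth g) :
    IsSmooth (fun K => f K * g K) :=
  .bilin (ContinuousLinearMap.mul ℝ (F →L[ℝ] F)) hf hg

theorem IsSmooth.mulLeftRight {R : Type*} [NormedRing R] [NormedAlgebra ℝ R] {f g : Tw V → R}
    (hf : IsSmooth f) (hg : IsSmooth g) :
    IsSmooth (fun K => ContinuousLinearMap.mulLeftRight ℝ R (f K) (g K)) :=
  hf.bilin (ContinuousLinearMap.mulLeftRight ℝ R) hg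

theorem IsSmooth.neg {f : Tw V → F} (hf : IsSmooth f) : IsSmooth (fun K => -f K) := by
  simpa using hf.clm_comp (-ContinuousLinearMap.id ℝ F)

theorem IsSmooth.sub {f g : Tw V → F} (hf : IsSmooth f) (hg : IsSmooth g) :
    IsSmooth (fun K => f K - g K) := by
  simp only [sub_eq_add_neg]
  exact hf.add hg.neg

theorem IsSmooth.lie {f g : Tw V → (F →L[ℝ] F)} (hf : IsSmooth f) (hg : IsSmooth g) :
    IsSmooth (fun K => ⁅f K, g K⁆) :=
  (hf.mul hg).sub (hg.mul hf)

theorem IsSmooth.continuous {f : Tw V → F} (hf : IsSmooth f) : Continuous f := by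
  refine continuous_iff_continuousAt.2 fun K => ?_
  obtain ⟨U, g, hU, hK, hg, hfg⟩ := hf K
  have hgK : ContinuousAt (fun L : Tw V => g L.1) K :=
    ContinuousAt.comp (hg.continuousOn.continuousAt (hU.mem_nhds hK))
      continuous_subtype_val.continuousAt
  refine hgK.congr ?_
  filter_upwards [(hU.preimage continuous_subtype_val).mem_nhds hK] with L hL using hfg L hL

theorem lieBr_apply (X Y : Tw V → (V →L[ℝ] V)) (K : Tw V) :
    lieBr X Y K = dd Y K (X K) - dd X K (Y K) := by
  simp only [lieBr, VectorField.lieBracketWithin, dd, ext_apply]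

variable [CompleteSpace V] {K : Tw V} {X : V →L[ℝ] V}

theorem dd_eq {f : Tw V → F} {f' : (V →L[ℝ] V) →L[ℝ] F}
    (hf : HasFDerivWithinAt (ext f) f' (twistorSet V) K.1) (hX : X ∈ tangent K) :
    dd f K X = f' X :=
  hf.differentiableWithinAt.hasFDerivWithinAt.unique_on hf (tangent_subset_tangentConeAt K hX)

theorem IsSmooth.dd {f : Tw V → F} {Y : Tw V → (V →L[ℝ] V)} (hf : IsSmooth f) (hY : IsSmooth Y)
    (hYt : ∀ K, Y K ∈ tangent K) : IsSmooth (fun K => dd f K (Y K)) := by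
  intro K
  obtain ⟨U, f', hU, hKU, hf', hff⟩ := hf K
  obtain ⟨W, Y', hW, hKW, hY', hYY⟩ := hY K
  refine ⟨U ∩ W, fun x => fderiv ℝ f' x (Y' x), hU.inter hW, ⟨hKU, hKW⟩,
    ((hf'.fderiv_of_isOpen hU (by simp)).mono Set.inter_subset_left).clm_apply
      (hY'.mono Set.inter_subset_right), fun L hL => ?_⟩
  simp only [dd_eq (hasFDerivWithinAt_ext hU hL.1 hf' hff) (hYt L), hYY L hL.2]

theorem dd_const (c : F) (hX : X ∈ tangent K) : dd (fun _ : Tw V => c) K X = 0 := by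
  simpa using dd_eq (hasFDerivWithinAt_ext (f := fun _ : Tw V => c) isOpen_univ
    (Set.mem_univ K.1) contDiffOn_const fun _ _ => rfl) hX

theorem dd_val (hX : X ∈ tangent K) : dd (fun L : Tw V => L.1) K X = X := by
  simpa using dd_eq (hasFDerivWithinAt_ext (f := fun L : Tw V => L.1) (g := id) isOpen_univ
    (Set.mem_univ K.1) contDiffOn_id fun _ _ => rfl) hX

theorem dd_add {f g : Tw V → F} (hf : IsSmooth f) (hg : IsSmooth g) (hX : X ∈ tangent K) :
    dd (fun L => f L + g L) K X = dd f K X + dd g K X := by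
  refine dd_eq (f := fun L => f L + g L) (((hf.hasFDerivWithinAt K).add
    (hg.hasFDerivWithinAt K)).congr (fun L hL => ?_) ?_) hX
  · simp only [Pi.add_apply, ext_of_mem _ hL]
  · simp only [Pi.add_apply, ext_apply]

theorem dd_clm_comp {f : Tw V → F} (hf : IsSmooth f) (T : F →L[ℝ] G) (hX : X ∈ tangent K) :
    dd (fun L => T (f L)) K X = T (dd f K X) := by
  refine dd_eq (f := fun L => T (f L)) ((T.hasFDerivAt.comp_hasFDerivWithinAt K.1
    (hf.hasFDerivWithinAt K)).congr (fun L hL => ?_) ?_) hX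
  · simp only [Function.comp_apply, ext_of_mem _ hL]
  · simp only [Function.comp_apply, ext_apply]

theorem dd_bilin (T : F →L[ℝ] G →L[ℝ] H) {f : Tw V → F} {g : Tw V → G} (hf : IsSmooth f)
    (hg : IsSmooth g) (hX : X ∈ tangent K) :
    dd (fun L => T (f L) (g L)) K X = T (dd f K X) (g K) + T (f K) (dd g K X) := by
  have h := dd_eq (f := fun L => T (f L) (g L)) ((T.hasFDerivWithinAt_of_bilinear
    (hf.hasFDerivWithinAt K) (hg.hasFDerivWithinAt K)).congr (fun L hL => ?_) ?_) hX
  · simpa [ext_apply, dd, add_comm] using h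
  · simp only [ext_of_mem _ hL]
  · simp only [ext_apply]

theorem dd_smul {a : Tw V → ℝ} {f : Tw V → F} (ha : IsSmooth a) (hf : IsSmooth f)
    (hX : X ∈ tangent K) :
    dd (fun L => a L • f L) K X = dd a K X • f K + a K • dd f K X :=
  dd_bilin (ContinuousLinearMap.lsmul ℝ ℝ) ha hf hX

theorem dd_mul {f g : Tw V → (F →L[ℝ] F)} (hf : IsSmooth f) (hg : IsSmooth g)
    (hX : X ∈ tangent K) :
    dd (fun L => f L * g L) K X = dd f K X * g K + f K * dd g K X :=
  dd_bilin (ContinuousLinearMap.mul ℝ (F →L[ℝ] F)) hf hg hX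

theorem dd_lie {f g : Tw V → (F →L[ℝ] F)} (hf : IsSmooth f) (hg : IsSmooth g)
    (hX : X ∈ tangent K) :
    dd (fun L => ⁅f L, g L⁆) K X = ⁅dd f K X, g K⁆ + ⁅f K, dd g K X⁆ :=
  dd_bilin (ContinuousLinearMap.mul ℝ (F →L[ℝ] F) - (ContinuousLinearMap.mul ℝ (F →L[ℝ] F)).flip)
    hf hg hX

theorem dd_mem {W : Submodule ℝ F} (hW : W.ClosedComplemented) {f : Tw V → F} (hf : IsSmooth f)
    (hfW : ∀ K, f K ∈ W) (hX : X ∈ tangent K) : dd f K X ∈ W := by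
  obtain ⟨P, hP⟩ := hW
  have hfP : (fun L => (W.subtypeL.comp P) (f L)) = f :=
    funext fun L => congrArg Subtype.val (hP ⟨f L, hfW L⟩)
  rw [← hfP, dd_clm_comp hf _ hX]
  exact (P (dd f K X)).2

end Calculus

section Projection

theorem semiconjBy_of_isIdempotentElem {R : Type*} [Ring R] {p q : R} (hp : IsIdempotentElem p)
    (hq : IsIdempotentElem q) : SemiconjBy (p * q + (1 - p) * (1 - q)) q p := by
  calc (p * q + (1 - p) * (1 - q)) * q = p * (q * q) + (1 - p) * (q - q * q) := by noncomm_ring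
    _ = p * p * q + (p - p * p) * (1 - q) := by rw [hp, hq, sub_self, sub_self]; noncomm_ring
    _ = p * (p * q + (1 - p) * (1 - q)) := by noncomm_ring

theorem map_range_eq_of_semiconjBy {W : Type*} [NormedAddCommGroup W] [NormedSpace ℝ W]
    {T P₀ P : W →L[ℝ] W} (h : SemiconjBy T P₀ P) (hT : Function.Surjective T) :
    P₀.range.map T.toLinearMap = P.range := by
  have hcomp : T.toLinearMap ∘ₗ P₀.toLinearMap = P.toLinearMap ∘ₗ T.toLinearMap :=
    congrArg ContinuousLinearMap.toLinearMap h.eq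
  rw [← LinearMap.range_comp, hcomp,
    LinearMap.range_comp_of_range_eq_top _ (LinearMap.range_eq_top.2 hT)]

theorem isOpen_setOf_bijective {W : Type*} [NormedAddCommGroup W] [NormedSpace ℝ W]
    [CompleteSpace W] : IsOpen {T : W →L[ℝ] W | Function.Bijective T} := by
  simp only [← ContinuousLinearMap.isUnit_iff_bijective]
  exact Units.isOpen

variable {V : Type*} [NormedAddCommGroup V] [InnerProductSpace ℝ V]

/-- `P` is a smooth family of projections of `End V` onto the fibres of `E`. -/
structure IsBundleProj (E : Tw V → Submodule ℝ (V →L[ℝ] V))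
    (P : Tw V → (V →L[ℝ] V) →L[ℝ] (V →L[ℝ] V)) : Prop where
  smooth : IsSmooth P
  mem : ∀ K A, P K A ∈ E K
  fix : ∀ K, ∀ A ∈ E K, P K A = A

namespace IsBundleProj

variable {E : Tw V → Submodule ℝ (V →L[ℝ] V)} {P : Tw V → (V →L[ℝ] V) →L[ℝ] (V →L[ℝ] V)}

theorem isIdempotentElem (hP : IsBundleProj E P) (K : Tw V) : IsIdempotentElem (P K) :=
  ContinuousLinearMap.ext fun A => hP.fix K _ (hP.mem K A)

theorem range_eq (hP : IsBundleProj E P) (K : Tw V) : (P K).range = E K := by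
  ext A
  refine ⟨?_, fun hA => ⟨A, hP.fix K A hA⟩⟩
  rintro ⟨B, rfl⟩
  exact hP.mem K B

theorem closedComplemented (hP : IsBundleProj E P) (K : Tw V) : (E K).ClosedComplemented :=
  ⟨(P K).codRestrict (E K) (hP.mem K), fun A => Subtype.ext (hP.fix K A A.2)⟩

/-- Near `K₀` the operators `P K ∘ P K₀ + (1 - P K) ∘ (1 - P K₀)` are invertible and carry `E K₀`
onto `E K`, so they transport a basis of `E K₀` to a frame of `E`. -/
theorem isSubbundle [FiniteDimensional ℝ V] (hP : IsBundleProj E P) : IsSubbundle E := by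
  intro K₀
  have : CompleteSpace V := FiniteDimensional.complete ℝ V
  let T : Tw V → (V →L[ℝ] V) →L[ℝ] (V →L[ℝ] V) :=
    fun K => P K * P K₀ + (1 - P K) * (1 - P K₀)
  have hcompl : IsSmooth fun K => 1 - P K := (isSmooth_const 1).sub hP.smooth
  have hT : IsSmooth T :=
    (hP.smooth.mul (isSmooth_const (P K₀))).add (hcompl.mul (isSmooth_const (1 - P K₀)))
  have hT₀ : T K₀ = 1 := by
    simp only [T, mul_sub, sub_mul, (hP.isIdempotentElem K₀).eq]
    simp
  let b := Module.finBasis ℝ (E K₀)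
  refine ⟨T ⁻¹' {A | Function.Bijective A}, _, fun i K => T K (b i),
    isOpen_setOf_bijective.preimage hT.continuous, by simpa [hT₀] using Function.bijective_id,
    fun i K _ => hT.clm_apply (isSmooth_const _) K, fun K hK => ?_⟩
  obtain ⟨hinj, hsurj⟩ : Function.Bijective (T K) := hK
  have hmap : (E K₀).map (T K).toLinearMap = E K := by
    rw [← hP.range_eq, ← hP.range_eq]
    exact map_range_eq_of_semiconjBy (semiconjBy_of_isIdempotentElem (hP.isIdempotentElem K)
      (hP.isIdempotentElem K₀)) hsurj
  constructor
  · exact (b.linearIndependent.map' (E K₀).subtype (Submodule.ker_subtype _)).map'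
      (T K).toLinearMap (LinearMap.ker_eq_bot.2 hinj)
  · have hrange : Set.range (fun i => T K (b i)) =
        ((T K).toLinearMap ∘ₗ (E K₀).subtype) '' Set.range b :=
      Set.range_comp ((T K).toLinearMap ∘ₗ (E K₀).subtype) b
    rw [hrange, Submodule.span_image, b.span_eq, Submodule.map_comp, Submodule.map_subtype_top,
      hmap]

end IsBundleProj

section Gen

theorem Gen.isSmooth (γ : Gen) (J : Tw V) : IsSmooth (γ.sec J) := by
  cases γ
  · exact isSmooth_const _
  · exact isSmooth_const _
  · exact isSmooth_val
  · exact isSmooth_val.neg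

variable [CompleteSpace V]

theorem neg_mem_twistorSet {A : V →L[ℝ] V} (hA : A ∈ twistorSet V) : -A ∈ twistorSet V := by
  simpa [mem_twistorSet_iff, neg_eq_iff_eq_neg] using hA

theorem Gen.mem_twistorSet (γ : Gen) (J K : Tw V) : γ.sec J K ∈ twistorSet V := by
  cases γ
  exacts [J.2, neg_mem_twistorSet J.2, K.2, neg_mem_twistorSet K.2]

end Gen

variable [CompleteSpace V]

variable (V) in
/-- The projection of `End V` onto `𝔬(V,g)`. -/
def skewProj : (V →L[ℝ] V) →L[ℝ] (V →L[ℝ] V) :=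
  (1 / 2 : ℝ) • (1 - (starL' ℝ : (V →L[ℝ] V) ≃L[ℝ] (V →L[ℝ] V)).toContinuousLinearMap)

theorem skewProj_apply (A : V →L[ℝ] V) : skewProj V A = (1 / 2 : ℝ) • (A - star A) := rfl

theorem skewProj_mem (A : V →L[ℝ] V) : skewProj V A ∈ skewEnd V := by
  rw [mem_skewEnd_iff, skewProj_apply, star_smul, star_sub, star_star, star_trivial, ← smul_neg,
    neg_sub]

theorem skewProj_of_mem {A : V →L[ℝ] V} (hA : A ∈ skewEnd V) : skewProj V A = A := by
  rw [skewProj_apply, mem_skewEnd_iff.1 hA]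
  module

theorem isBundleProj_skewProj :
    IsBundleProj (fun _ : Tw V => skewEnd V) (fun _ => skewProj V) :=
  ⟨isSmooth_const _, fun _ => skewProj_mem, fun _ _ => skewProj_of_mem⟩

/-- For an orthogonal complex structure `η` and `σ = ±1`, the projection of `End V` onto
`{A ∈ 𝔬(V,g) | η A = σ A η}`. -/
def genProj (σ : ℝ) (η : V →L[ℝ] V) : (V →L[ℝ] V) →L[ℝ] (V →L[ℝ] V) :=
  ((1 / 2 : ℝ) • (1 - σ • ContinuousLinearMap.mulLeftRight ℝ (V →L[ℝ] V) η η)) * skewProj V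

theorem genProj_apply (σ : ℝ) (η A : V →L[ℝ] V) :
    genProj σ η A = (1 / 2 : ℝ) • (skewProj V A - σ • (η * skewProj V A * η)) := by
  simp [genProj]

theorem isSmooth_genProj (σ : ℝ) {η : Tw V → (V →L[ℝ] V)} (hη : IsSmooth η) :
    IsSmooth (fun K => genProj σ (η K)) := by
  have hcompl := (isSmooth_const (1 / 2 : ℝ)).smul ((isSmooth_const 1).sub
    ((isSmooth_const σ).smul (hη.mulLeftRight hη)))
  exact IsSmooth.mul hcompl (isSmooth_const (skewProj V))

variable {σ : ℝ} {η : V →L[ℝ] V}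

theorem genProj_mem_skewEnd (σ : ℝ) (hη : η ∈ twistorSet V) (A : V →L[ℝ] V) :
    genProj σ η A ∈ skewEnd V := by
  have hηB : η * skewProj V A * η ∈ skewEnd V := by
    rw [mem_skewEnd_iff, star_mul, star_mul, (mem_twistorSet_iff.1 hη).2,
      mem_skewEnd_iff.1 (skewProj_mem A)]
    noncomm_ring
  rw [genProj_apply]
  exact Submodule.smul_mem _ _ (sub_mem (skewProj_mem A) (Submodule.smul_mem _ _ hηB))

theorem mul_genProj (hη : η ∈ twistorSet V) (hσ : σ * σ = 1) (A : V →L[ℝ] V) :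
    η * genProj σ η A = σ • (genProj σ η A * η) := by
  have hsq : ∀ B, η * (η * B) = -B := Tw.mul_self_mul ⟨η, hη⟩
  rw [genProj_apply]
  simp only [mul_smul_comm, smul_mul_assoc, mul_sub, sub_mul, mul_assoc, hsq, hη.1]
  simp only [mul_neg, mul_one]
  linear_combination (norm := module) (-(1 / 2 : ℝ) * hσ) • (η * skewProj V A)

theorem genProj_of_mul_eq (hη : η ∈ twistorSet V) (hσ : σ * σ = 1) {A : V →L[ℝ] V}
    (hA : A ∈ skewEnd V) (h : η * A = σ • (A * η)) : genProj σ η A = A := by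
  rw [genProj_apply, skewProj_of_mem hA, h, smul_mul_assoc, mul_assoc, hη.1, smul_smul, hσ,
    mul_neg_one]
  module

theorem isBundleProj_genProj (J : Tw V) {γ δ : Gen} (hσ : σ * σ = 1)
    (hδ : ∀ K, δ.sec J K = σ • γ.sec J K) :
    IsBundleProj (genBundle J γ δ) (fun K => genProj σ (γ.sec J K)) where
  smooth := isSmooth_genProj σ (γ.isSmooth J)
  mem K A := by
    refine ⟨genProj_mem_skewEnd σ (γ.mem_twistorSet J K) A, ?_⟩
    rw [hδ, mul_smul_comm, mul_genProj (γ.mem_twistorSet J K) hσ]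
  fix K A hA := by
    refine genProj_of_mul_eq (γ.mem_twistorSet J K) hσ hA.1 ?_
    rw [hA.2, hδ, mul_smul_comm]

end Projection

section Adapted

variable {V : Type*} [NormedAddCommGroup V] [InnerProductSpace ℝ V]

theorem SType.sec_mem {𝒜 : Subalgebra ℝ (Tw V → (V →L[ℝ] V))} {J : Tw V}
    (hJ : (fun _ => J.1) ∈ 𝒜) (hφ : (fun K : Tw V => K.1) ∈ 𝒜) (S : SType) : S.sec J ∈ 𝒜 := by
  cases S
  exacts [one_mem 𝒜, add_mem hJ hφ, sub_mem hJ hφ, sub_mem (mul_mem hJ hφ) (mul_mem hφ hJ)]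

theorem polyQ_mem {𝒜 : Subalgebra ℝ (Tw V → (V →L[ℝ] V))} {J : Tw V}
    (hJ : (fun _ => J.1) ∈ 𝒜) (hφ : (fun K : Tw V => K.1) ∈ 𝒜) {k : ℕ}
    {a : Fin (k + 1) → Tw V → ℝ} (ha : ∀ i, (fun K => a i K • 1) ∈ 𝒜) : polyQ J a ∈ 𝒜 := by
  have hanti := add_mem (mul_mem hJ hφ) (mul_mem hφ hJ)
  have hsum := sum_mem fun (i : Fin (k + 1)) (_ : i ∈ Finset.univ) =>
    mul_mem (ha i) (pow_mem hanti i)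
  convert hsum using 1
  ext1 K
  simp [polyQ]

theorem anchor_eq_lie (F : Tw V → (V →L[ℝ] V)) (K : Tw V) (A : V →L[ℝ] V) :
    anchor F K A = ⁅F K * A * F K, K.1⁆ := rfl

/-- `G` can be moved past `F` on either side, and the derivative of `G` along `[F A F, φ]` has the
form `F D(A) F` for a smooth bundle map `D`. -/
structure IsAdapted (E : Tw V → Submodule ℝ (V →L[ℝ] V)) (F G : Tw V → (V →L[ℝ] V)) : Prop where
  smooth : IsSmooth G
  semiconj : ∃ G' : Tw V → (V →L[ℝ] V), IsSmooth G' ∧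
    ∀ K, SemiconjBy (F K) (G K) (G' K) ∧ SemiconjBy (F K) (G' K) (G K)
  deriv : ∃ D : Tw V → (V →L[ℝ] V) →L[ℝ] (V →L[ℝ] V), IsSmooth D ∧
    ∀ K, ∀ A ∈ E K, dd G K (anchor F K A) = F K * D K A * F K

variable {E : Tw V → Submodule ℝ (V →L[ℝ] V)} {F G G' H : Tw V → (V →L[ℝ] V)}

theorem IsAdapted.of_dd_eq_zero (hG : IsSmooth G) (hG' : IsSmooth G')
    (h : ∀ K, SemiconjBy (F K) (G K) (G' K) ∧ SemiconjBy (F K) (G' K) (G K))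
    (hdd : ∀ K, ∀ A ∈ E K, dd G K (anchor F K A) = 0) : IsAdapted E F G :=
  ⟨hG, ⟨G', hG', h⟩, 0, isSmooth_const 0, fun K A hA => by simp [hdd K A hA]⟩

variable [CompleteSpace V]

theorem isAdapted_val (ht : ∀ K, ∀ A ∈ E K, anchor F K A ∈ tangent K) (hG' : IsSmooth G')
    (h : ∀ K : Tw V, SemiconjBy (F K) K.1 (G' K) ∧ SemiconjBy (F K) (G' K) K.1) :
    IsAdapted E F (fun K => K.1) := by
  refine ⟨isSmooth_val, ⟨G', hG', h⟩, fun K => (ContinuousLinearMap.mul ℝ _).flip (G' K) -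
    ContinuousLinearMap.mul ℝ _ (G' K), (hG'.clm_comp _).sub (hG'.clm_comp _), fun K A hA => ?_⟩
  calc dd (fun L : Tw V => L.1) K (anchor F K A)
      = F K * A * (F K * K.1) - K.1 * F K * A * F K := by
        rw [dd_val (ht K A hA), anchor_eq_lie, Ring.lie_def]
        noncomm_ring
    _ = F K * (A * G' K - G' K * A) * F K := by
        rw [(h K).1.eq, ← (h K).2.eq]
        noncomm_ring

theorem IsAdapted.add (ht : ∀ K, ∀ A ∈ E K, anchor F K A ∈ tangent K)
    (hG : IsAdapted E F G) (hH : IsAdapted E F H) : IsAdapted E F (fun K => G K + H K) := by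
  obtain ⟨G', hG', hGF⟩ := hG.semiconj
  obtain ⟨H', hH', hHF⟩ := hH.semiconj
  obtain ⟨D, hD, hdG⟩ := hG.deriv
  obtain ⟨D', hD', hdH⟩ := hH.deriv
  refine ⟨hG.smooth.add hH.smooth, ⟨_, hG'.add hH', fun K => ?_⟩, _, hD.add hD', fun K A hA => ?_⟩
  · exact ⟨(hGF K).1.add_right (hHF K).1, (hGF K).2.add_right (hHF K).2⟩
  · rw [dd_add hG.smooth hH.smooth (ht K A hA), hdG K A hA, hdH K A hA, Pi.add_apply, add_apply,
      mul_add, add_mul]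

theorem IsAdapted.mul (ht : ∀ K, ∀ A ∈ E K, anchor F K A ∈ tangent K)
    (hG : IsAdapted E F G) (hH : IsAdapted E F H) : IsAdapted E F (fun K => G K * H K) := by
  obtain ⟨G', hG', hGF⟩ := hG.semiconj
  obtain ⟨H', hH', hHF⟩ := hH.semiconj
  obtain ⟨D, hD, hdG⟩ := hG.deriv
  obtain ⟨D', hD', hdH⟩ := hH.deriv
  refine ⟨hG.smooth.mul hH.smooth, ⟨_, hG'.mul hH', fun K => ?_⟩,
    fun K => (ContinuousLinearMap.mul ℝ _).flip (H' K) * D K +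
      ContinuousLinearMap.mul ℝ _ (G' K) * D' K,
    ((hH'.clm_comp _).mul hD).add ((hG'.clm_comp _).mul hD'), fun K A hA => ?_⟩
  · exact ⟨(hGF K).1.mul_right (hHF K).1, (hGF K).2.mul_right (hHF K).2⟩
  · calc dd (fun L => G L * H L) K (anchor F K A)
        = F K * D K A * (F K * H K) + G K * F K * D' K A * F K := by
          rw [dd_mul hG.smooth hH.smooth (ht K A hA), hdG K A hA, hdH K A hA]
          noncomm_ring
      _ = F K * (D K A * H' K + G' K * D' K A) * F K := by
          rw [(hHF K).1.eq, ← (hGF K).2.eq]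
          noncomm_ring

/-- The algebra of sections adapted to `F`. -/
def adaptedSections (ht : ∀ K, ∀ A ∈ E K, anchor F K A ∈ tangent K) :
    Subalgebra ℝ (Tw V → (V →L[ℝ] V)) where
  carrier := {G | IsAdapted E F G}
  mul_mem' hG hH := hG.mul ht hH
  add_mem' hG hH := hG.add ht hH
  algebraMap_mem' r := .of_dd_eq_zero (isSmooth_const _) (isSmooth_const _)
    (fun K => and_self_iff.2 (Algebra.commute_algebraMap_right r (F K)))
    fun K A hA => dd_const _ (ht K A hA)

end Adapted

section Pullback

variable {V : Type*} [NormedAddCommGroup V] [InnerProductSpace ℝ V]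

/-- The bracket of the action algebroid of `𝔬(V,g)` acting on `𝒯` with infinitesimal action
`C ↦ [C, φ]`. -/
def actionBr (A B : Tw V → (V →L[ℝ] V)) (K : Tw V) : V →L[ℝ] V :=
  dd B K ⁅A K, K.1⁆ - dd A K ⁅B K, K.1⁆ - ⁅A K, B K⁆

/-- A pullback along `A ↦ F A F` of the derivative along the action, where `D` is such that
`dF_{[F A F, φ]} = F D(A) F`. The last term is not a derivation in `B`; it is there to make the
antisymmetrization a pullback of `actionBr`. -/
def pullbackConn (F : Tw V → (V →L[ℝ] V)) (D : Tw V → (V →L[ℝ] V) →L[ℝ] (V →L[ℝ] V))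
    (A B : Tw V → (V →L[ℝ] V)) (K : Tw V) : V →L[ℝ] V :=
  dd B K (anchor F K (A K)) + D K (A K) * F K * B K + B K * F K * D K (A K) -
    A K * F K * F K * B K

variable {F : Tw V → (V →L[ℝ] V)} {D : Tw V → (V →L[ℝ] V) →L[ℝ] (V →L[ℝ] V)}
  {A A' B B' : Tw V → (V →L[ℝ] V)} {K : Tw V}

theorem pullbackConn_add_left :
    pullbackConn F D (A + A') B K = pullbackConn F D A B K + pullbackConn F D A' B K := by
  simp only [pullbackConn, dd, Pi.add_apply, map_add, add_mul, mul_add]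
  abel

theorem pullbackConn_smul_left (c : Tw V → ℝ) :
    pullbackConn F D (fun L => c L • A L) B K = c K • pullbackConn F D A B K := by
  simp only [pullbackConn, dd, map_smul, smul_mul_assoc, mul_smul_comm, smul_add, smul_sub]

theorem isSmooth_anchor (hF : IsSmooth F) (hA : IsSmooth A) : IsSmooth (pushSec (anchor F) A) :=
  ((hF.mul hA).mul hF).lie isSmooth_val

variable [CompleteSpace V]

theorem lieBr_lie (hA : IsSmooth A) (hB : IsSmooth B) (hAs : ∀ K, A K ∈ skewEnd V)
    (hBs : ∀ K, B K ∈ skewEnd V) (K : Tw V) :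
    lieBr (fun L => ⁅A L, L.1⁆) (fun L => ⁅B L, L.1⁆) K = ⁅actionBr A B K, K.1⁆ := by
  have hAK := lie_mem_tangent (hAs K) K
  have hBK := lie_mem_tangent (hBs K) K
  rw [lieBr_apply, dd_lie hA isSmooth_val hBK, dd_lie hB isSmooth_val hAK, dd_val hAK, dd_val hBK,
    actionBr]
  simp only [Ring.lie_def]
  noncomm_ring

theorem pullbackConn_add_right (hB : IsSmooth B) (hB' : IsSmooth B')
    (hA : anchor F K (A K) ∈ tangent K) :
    pullbackConn F D A (B + B') K = pullbackConn F D A B K + pullbackConn F D A B' K := by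
  have hdd : dd (B + B') K (anchor F K (A K)) = _ := dd_add hB hB' hA
  simp only [pullbackConn, hdd, Pi.add_apply, add_mul, mul_add]
  abel

theorem pullbackConn_smul_right {c : Tw V → ℝ} (hc : IsSmooth c) (hB : IsSmooth B)
    (hA : anchor F K (A K) ∈ tangent K) :
    pullbackConn F D A (fun L => c L • B L) K =
      c K • pullbackConn F D A B K + dd c K (anchor F K (A K)) • B K := by
  simp only [pullbackConn, dd_smul hc hB hA, smul_mul_assoc, mul_smul_comm, smul_add, smul_sub]
  abel

theorem isSmooth_pullbackConn (hF : IsSmooth F) (hD : IsSmooth D) (hA : IsSmooth A)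
    (hB : IsSmooth B) (ht : ∀ K, anchor F K (A K) ∈ tangent K) :
    IsSmooth (pullbackConn F D A B) := by
  have hDA : IsSmooth fun K => D K (A K) := hD.clm_apply hA
  have hsum := ((hB.dd (isSmooth_anchor hF hA) ht).add ((hDA.mul hF).mul hB)).add
    ((hB.mul hF).mul hDA)
  exact hsum.sub (((hA.mul hF).mul hF).mul hB)

theorem dd_conj (hF : IsSmooth F) (hB : IsSmooth B) (ht : anchor F K (A K) ∈ tangent K)
    (hD : dd F K (anchor F K (A K)) = F K * D K (A K) * F K) :
    dd (fun L => F L * B L * F L) K (anchor F K (A K)) =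
      F K * (pullbackConn F D A B K + A K * F K * F K * B K) * F K := by
  rw [dd_mul (hF.mul hB) hF ht, dd_mul hF hB ht, hD, pullbackConn]
  noncomm_ring

theorem conj_pullbackConn_sub (hF : IsSmooth F) (hA : IsSmooth A) (hB : IsSmooth B)
    (htA : anchor F K (A K) ∈ tangent K) (htB : anchor F K (B K) ∈ tangent K)
    (hDA : dd F K (anchor F K (A K)) = F K * D K (A K) * F K)
    (hDB : dd F K (anchor F K (B K)) = F K * D K (B K) * F K) :
    F K * (pullbackConn F D A B K - pullbackConn F D B A K) * F K =
      actionBr (fun L => F L * A L * F L) (fun L => F L * B L * F L) K := by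
  rw [actionBr, ← anchor_eq_lie, ← anchor_eq_lie, dd_conj hF hB htA hDA, dd_conj hF hA htB hDB,
    Ring.lie_def]
  noncomm_ring

variable {E E₀ : Tw V → Submodule ℝ (V →L[ℝ] V)} {P P₀ : Tw V → (V →L[ℝ] V) →L[ℝ] (V →L[ℝ] V)}

/-- The operation induced on `Γ(E)` by `pullbackConn` and a projection onto `E`. -/
def projConn (hP : IsBundleProj E P) (hF : IsSmooth F) (hD : IsSmooth D)
    (ht : ∀ K, ∀ A ∈ E K, anchor F K A ∈ tangent K) : Gam E →ₗ[ℝ] Gam E →ₗ[ℝ] Gam E :=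
  LinearMap.mk₂ ℝ
    (fun A B => ⟨fun K => P K (pullbackConn F D A.1 B.1 K),
      hP.smooth.clm_apply (isSmooth_pullbackConn hF hD A.2.1 B.2.1 fun K => ht K _ (A.2.2 K)),
      fun K => hP.mem K _⟩)
    (fun A A' B => Subtype.ext <| funext fun K => by
      simp [pullbackConn_add_left])
    (fun c A B => Subtype.ext <| funext fun K => by
      have hsmul : pullbackConn F D (fun L => c • A.1 L) B.1 K = c • pullbackConn F D A.1 B.1 K :=
        pullbackConn_smul_left fun _ => c
      exact (congrArg (P K) hsmul).trans (map_smul _ _ _))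
    (fun A B B' => Subtype.ext <| funext fun K => by
      simp [pullbackConn_add_right B.2.1 B'.2.1 (ht K _ (A.2.2 K))])
    (fun c A B => Subtype.ext <| funext fun K => by
      have hsmul := pullbackConn_smul_right (D := D) (isSmooth_const c) B.2.1 (ht K _ (A.2.2 K))
      rw [dd_const c (ht K _ (A.2.2 K)), zero_smul, add_zero] at hsmul
      exact (congrArg (P K) hsmul).trans (map_smul _ _ _))

theorem exists_isSkewAlgebroid [FiniteDimensional ℝ V] (hP : IsBundleProj E P)
    (hP₀ : IsBundleProj E₀ P₀) (hE₀ : ∀ K, E₀ K ≤ skewEnd V)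
    (hPF : ∀ K C, F K * P K C * F K = P₀ K (F K * C * F K))
    (hF : IsAdapted E F F)
    (hbr : ∀ A ∈ Gam E₀, ∀ B ∈ Gam E₀, ∀ K,
      ⁅P₀ K (actionBr A B K), K.1⁆ = ⁅actionBr A B K, K.1⁆) :
    ∃ br : Gam E →ₗ[ℝ] Gam E →ₗ[ℝ] Gam E, IsSkewAlgebroid E br (anchor F) := by
  obtain ⟨D, hD, hdF⟩ := hF.deriv
  have hconj : ∀ K, ∀ A ∈ E K, F K * A * F K ∈ E₀ K := fun K A hA => by
    rw [← hP.fix K A hA, hPF]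
    exact hP₀.mem K _
  have hconjΓ : ∀ A ∈ Gam E, (fun K => F K * A K * F K) ∈ Gam E₀ := fun A hA =>
    ⟨(hF.smooth.mul hA.1).mul hF.smooth, fun K => hconj K _ (hA.2 K)⟩
  have ht : ∀ K, ∀ A ∈ E K, anchor F K A ∈ tangent K := fun K A hA =>
    lie_mem_tangent (hE₀ K (hconj K A hA)) K
  let conn := projConn hP hF.smooth hD ht
  -- No subtraction is inferred on this type of bilinear maps.
  let br := conn + (-1 : ℝ) • conn.flip
  have br_apply (A B : Gam E) (K : Tw V) : (br A B).1 K =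
      P K (pullbackConn F D A.1 B.1 K) - P K (pullbackConn F D B.1 A.1 K) :=
    (congrArg _ (neg_one_smul ℝ _)).trans (sub_eq_add_neg _ _).symm
  refine ⟨br, hP.isSubbundle, ht, fun A => isSmooth_anchor hF.smooth A.2.1,
    fun A B => Subtype.ext <| funext fun K => ?_, fun A B => funext fun K => ?_,
    fun A B f hf K => ?_⟩
  · exact (br_apply A B K).trans <| (neg_sub _ _).symm.trans <| congrArg _ (br_apply B A K).symm
  · have hA := hconjΓ A.1 A.2
    have hB := hconjΓ B.1 B.2
    calc anchor F K ((br A B).1 K)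
        = ⁅P₀ K (actionBr (fun L => F L * A.1 L * F L) (fun L => F L * B.1 L * F L) K), K.1⁆ := by
          rw [br_apply, ← map_sub, anchor_eq_lie, hPF, conj_pullbackConn_sub hF.smooth A.2.1 B.2.1
            (ht K _ (A.2.2 K)) (ht K _ (B.2.2 K)) (hdF K _ (A.2.2 K)) (hdF K _ (B.2.2 K))]
      _ = lieBr (pushSec (anchor F) A.1) (pushSec (anchor F) B.1) K := by
          rw [hbr _ hA _ hB]
          exact (lieBr_lie hA.1 hB.1 (fun L => hE₀ L (hA.2 L)) (fun L => hE₀ L (hB.2 L)) K).symm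
  · rw [br_apply, br_apply, mulSec, pullbackConn_smul_left,
      pullbackConn_smul_right hf B.2.1 (ht K _ (A.2.2 K)), map_add, map_smul, map_smul, map_smul,
      hP.fix K _ (B.2.2 K)]
    module

end Pullback

section PolyQ

variable {V : Type*} [NormedAddCommGroup V] [InnerProductSpace ℝ V]

theorem Gen.tilde_negPhi_sec (S : SType) (J K : Tw V) :
    (Gen.negPhi.tilde S).sec J K = (-1 : ℝ) • (Gen.posPhi.tilde S).sec J K := by
  cases S <;> simp [Gen.tilde, Gen.sec]

section Commute

variable {J : Tw V} {k : ℕ} (a : Fin (k + 1) → Tw V → ℝ) {K : Tw V}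

theorem commute_polyQ_of_commute {X : V →L[ℝ] V} (h : Commute X (J.1 * K.1 + K.1 * J.1)) :
    Commute X (polyQ J a K) :=
  Commute.sum_right _ _ _ fun i _ => (h.pow_right i).smul_right (a i K)

theorem Gen.commute_polyQ (γ : Gen) : Commute (γ.sec J K) (polyQ J a K) := by
  have hJ : Commute J.1 (J.1 * K.1 + K.1 * J.1) := by
    rw [Commute, SemiconjBy, mul_add, add_mul, J.mul_self_mul, mul_assoc K.1, J.mul_self]
    noncomm_ring
  have hφ : Commute K.1 (J.1 * K.1 + K.1 * J.1) := by
    rw [Commute, SemiconjBy, mul_add, add_mul, K.mul_self_mul, mul_assoc J.1, K.mul_self]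
    noncomm_ring
  cases γ
  exacts [commute_polyQ_of_commute a hJ, (commute_polyQ_of_commute a hJ).neg_left,
    commute_polyQ_of_commute a hφ, (commute_polyQ_of_commute a hφ).neg_left]

theorem SType.commute_polyQ (S : SType) : Commute (S.sec J K) (polyQ J a K) := by
  have hJ : Commute J.1 (polyQ J a K) := Gen.posJ.commute_polyQ a
  have hφ : Commute K.1 (polyQ J a K) := Gen.posPhi.commute_polyQ a
  cases S
  exacts [.one_left _, hJ.add_left hφ, hJ.sub_left hφ, (hJ.mul_left hφ).sub_left (hφ.mul_left hJ)]

theorem Gen.semiconjBy_tilde (γ : Gen) (S : SType) :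
    SemiconjBy (polyQ J a K * S.sec J K) (γ.sec J K) ((γ.tilde S).sec J K) :=
  .mul_left ((γ.tilde S).commute_polyQ a).symm (Gen.S_mul S γ J K)

theorem Gen.tilde_semiconjBy (γ : Gen) (S : SType) :
    SemiconjBy (polyQ J a K * S.sec J K) ((γ.tilde S).sec J K) (γ.sec J K) :=
  .mul_left (γ.commute_polyQ a).symm (Gen.mul_S S γ J K).symm

end Commute

theorem anchor_mul_of_commute {Q G : Tw V → (V →L[ℝ] V)} {K : Tw V} (h : Commute (G K) (Q K))
    (A : V →L[ℝ] V) :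
    anchor (fun L => Q L * G L) K A = anchor G K (Q K * A * Q K) := by
  have hconj : Q K * G K * A * (Q K * G K) = G K * (Q K * A * Q K) * G K := by
    rw [← h.eq, mul_assoc (G K), mul_assoc (G K), h.eq]
    noncomm_ring
  rw [anchor_eq_lie, anchor_eq_lie, hconj]

variable [CompleteSpace V]

section Star

variable {A F η η' : V →L[ℝ] V}

theorem star_polyQ (J : Tw V) {k : ℕ} (a : Fin (k + 1) → Tw V → ℝ) (K : Tw V) :
    star (polyQ J a K) = polyQ J a K := by
  simp [polyQ, star_sum, J.star_eq, K.star_eq, add_comm]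

theorem SType.star_sec (S : SType) (J K : Tw V) :
    star (S.sec J K) = S.sec J K ∨ star (S.sec J K) = -S.sec J K := by
  cases S
  · exact .inl (star_one _)
  · exact .inr (by rw [SType.sec, star_add, J.star_eq, K.star_eq, neg_add])
  · exact .inr (by rw [SType.sec, star_sub, J.star_eq, K.star_eq]; abel)
  · exact .inr (by simp [SType.sec, J.star_eq, K.star_eq])

theorem star_polyQ_mul_sec (J : Tw V) {k : ℕ} (a : Fin (k + 1) → Tw V → ℝ) (S : SType)
    (K : Tw V) : star (polyQ J a K * S.sec J K) = polyQ J a K * S.sec J K ∨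
      star (polyQ J a K * S.sec J K) = -(polyQ J a K * S.sec J K) := by
  rw [star_mul, star_polyQ, ← (S.commute_polyQ a).eq, ← neg_mul]
  exact (S.star_sec J K).imp (congrArg (· * _)) (congrArg (· * _))

theorem conj_skewProj (hF : star F = F ∨ star F = -F) (A : V →L[ℝ] V) :
    F * skewProj V A * F = skewProj V (F * A * F) := by
  have hstar : star (F * A * F) = F * star A * F := by
    rcases hF with h | h <;> simp [h, mul_assoc]
  rw [skewProj_apply, skewProj_apply, hstar, mul_smul_comm, smul_mul_assoc, mul_sub, sub_mul]

theorem conj_mem_skewEnd (hF : star F = F ∨ star F = -F) (hA : A ∈ skewEnd V) :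
    F * A * F ∈ skewEnd V := by
  rw [← skewProj_of_mem hA, conj_skewProj hF]
  exact skewProj_mem _

theorem conj_genProj (hF : star F = F ∨ star F = -F) (h : SemiconjBy F η η')
    (h' : SemiconjBy F η' η) (σ : ℝ) (A : V →L[ℝ] V) :
    F * genProj σ η A * F = genProj σ η' (F * A * F) := by
  have hconj (B : V →L[ℝ] V) : F * (η * B * η) * F = η' * (F * B * F) * η' := by
    calc F * (η * B * η) * F = F * η * B * (η * F) := by noncomm_ring
      _ = η' * (F * B * F) * η' := by
        rw [h.eq, ← h'.eq]
        noncomm_ring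
  rw [genProj_apply, genProj_apply, ← conj_skewProj hF, ← hconj]
  simp only [mul_smul_comm, smul_mul_assoc, mul_sub, sub_mul]

end Star

variable {J : Tw V} {S : SType} {k : ℕ} {a : Fin (k + 1) → Tw V → ℝ}
  {E E₀ : Tw V → Submodule ℝ (V →L[ℝ] V)} {P P₀ : Tw V → (V →L[ℝ] V) →L[ℝ] (V →L[ℝ] V)}

theorem isAdapted_polyQ_mul_sec (hE : ∀ K, E K ≤ skewEnd V) (ha : ∀ i, IsSmooth (a i))
    (hda : ∀ i K, ∀ A ∈ E K, dd (a i) K (anchor (fun K => polyQ J a K * S.sec J K) K A) = 0) :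
    IsAdapted E (fun K => polyQ J a K * S.sec J K) (fun K => polyQ J a K * S.sec J K) := by
  have ht : ∀ K, ∀ A ∈ E K, anchor (fun K => polyQ J a K * S.sec J K) K A ∈ tangent K :=
    fun K A hA => lie_mem_tangent (conj_mem_skewEnd (star_polyQ_mul_sec J a S K) (hE K hA)) K
  have hJ : (fun _ => J.1) ∈ adaptedSections ht :=
    .of_dd_eq_zero (isSmooth_const _) ((Gen.posJ.tilde S).isSmooth J)
      (fun K => ⟨Gen.posJ.semiconjBy_tilde a S, Gen.posJ.tilde_semiconjBy a S⟩)
      fun K A hA => dd_const _ (ht K A hA)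
  have hφ : (fun K : Tw V => K.1) ∈ adaptedSections ht :=
    isAdapted_val ht ((Gen.posPhi.tilde S).isSmooth J)
      fun K => ⟨Gen.posPhi.semiconjBy_tilde a S, Gen.posPhi.tilde_semiconjBy a S⟩
  have ha' (i : Fin (k + 1)) : (fun K => a i K • 1) ∈ adaptedSections ht := by
    have hsmooth : IsSmooth fun K => a i K • (1 : V →L[ℝ] V) := (ha i).smul (isSmooth_const 1)
    refine .of_dd_eq_zero hsmooth hsmooth
      (fun K => and_self_iff.2 ((Commute.one_right _).smul_right _)) fun K A hA => ?_
    rw [dd_smul (ha i) (isSmooth_const 1) (ht K A hA), hda i K A hA, dd_const _ (ht K A hA),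
      zero_smul, smul_zero, add_zero]
  exact mul_mem (polyQ_mem hJ hφ ha') (S.sec_mem hJ hφ)

theorem exists_isSkewAlgebroid_polyQ_mul_sec [FiniteDimensional ℝ V] (hP : IsBundleProj E P)
    (hP₀ : IsBundleProj E₀ P₀) (hE : ∀ K, E K ≤ skewEnd V) (hE₀ : ∀ K, E₀ K ≤ skewEnd V)
    (hPQ : ∀ K C, polyQ J a K * P K C * polyQ J a K = P K (polyQ J a K * C * polyQ J a K))
    (hPF : ∀ K C, polyQ J a K * S.sec J K * P K C * (polyQ J a K * S.sec J K) =
      P₀ K (polyQ J a K * S.sec J K * C * (polyQ J a K * S.sec J K)))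
    (hbr : ∀ A ∈ Gam E₀, ∀ B ∈ Gam E₀, ∀ K,
      ⁅P₀ K (actionBr A B K), K.1⁆ = ⁅actionBr A B K, K.1⁆)
    (ha : ∀ i, IsSmooth (a i))
    (hda : ∀ i, ∀ C ∈ Gam E, ∀ K, dd (a i) K (anchor (S.sec J) K (C K)) = 0) :
    ∃ br : Gam E →ₗ[ℝ] Gam E →ₗ[ℝ] Gam E,
      IsSkewAlgebroid E br (anchor fun K => polyQ J a K * S.sec J K) := by
  refine exists_isSkewAlgebroid hP hP₀ hE₀ hPF (isAdapted_polyQ_mul_sec hE ha ?_) hbr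
  intro i K A hA
  let C : Tw V → (V →L[ℝ] V) := fun L => P L (polyQ J a K * A * polyQ J a K)
  have hC : C ∈ Gam E := ⟨hP.smooth.clm_apply (isSmooth_const _), fun L => hP.mem L _⟩
  have hCK : C K = polyQ J a K * A * polyQ J a K :=
    (hPQ K A).symm.trans (by rw [hP.fix K A hA])
  rw [anchor_mul_of_commute (S.commute_polyQ a), ← hCK]
  exact hda i C hC K

end PolyQ

section ActionBracket

variable {V : Type*} [NormedAddCommGroup V] [InnerProductSpace ℝ V] [CompleteSpace V]
  {A B : Tw V → (V →L[ℝ] V)}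

theorem actionBr_mem {W : Submodule ℝ (V →L[ℝ] V)} (hW : W.ClosedComplemented)
    (hskew : W ≤ skewEnd V) (hlie : ∀ A ∈ W, ∀ B ∈ W, ⁅A, B⁆ ∈ W) (hA : A ∈ Gam fun _ => W)
    (hB : B ∈ Gam fun _ => W) (K : Tw V) : actionBr A B K ∈ W :=
  sub_mem (sub_mem (dd_mem hW hB.1 hB.2 (lie_mem_tangent (hskew (hA.2 K)) K))
    (dd_mem hW hA.1 hA.2 (lie_mem_tangent (hskew (hB.2 K)) K))) (hlie _ (hA.2 K) _ (hB.2 K))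

theorem actionBr_mem_skewEnd (hA : A ∈ Gam fun _ => skewEnd V) (hB : B ∈ Gam fun _ => skewEnd V)
    (K : Tw V) : actionBr A B K ∈ skewEnd V :=
  actionBr_mem (isBundleProj_skewProj.closedComplemented K) le_rfl
    (fun _ hA _ hB => lie_mem_skewEnd hA hB) hA hB K

theorem lie_mem_genBundle {J K : Tw V} {γ : Gen} {A B : V →L[ℝ] V}
    (hA : A ∈ genBundle J γ γ K) (hB : B ∈ genBundle J γ γ K) : ⁅A, B⁆ ∈ genBundle J γ γ K := by
  have hA' : Commute (γ.sec J K) A := hA.2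
  have hB' : Commute (γ.sec J K) B := hB.2
  exact ⟨lie_mem_skewEnd hA.1 hB.1, (hA'.mul_right hB').sub_right (hB'.mul_right hA')⟩

theorem isBundleProj_genProj_one (J : Tw V) (γ : Gen) :
    IsBundleProj (genBundle J γ γ) (fun K => genProj 1 (γ.sec J K)) :=
  isBundleProj_genProj J (one_mul 1) fun _ => (one_smul ℝ _).symm

theorem actionBr_mem_genBundle_posJ {J : Tw V} (hA : A ∈ Gam (genBundle J .posJ .posJ))
    (hB : B ∈ Gam (genBundle J .posJ .posJ)) (K : Tw V) :
    actionBr A B K ∈ genBundle J .posJ .posJ K :=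
  actionBr_mem ((isBundleProj_genProj_one J .posJ).closedComplemented K) (fun _ h => h.1)
    (fun _ hA _ hB => lie_mem_genBundle hA hB) hA hB K

theorem actionBr_mem_genBundle_posPhi {J : Tw V} (hA : A ∈ Gam (genBundle J .posPhi .posPhi))
    (hB : B ∈ Gam (genBundle J .posPhi .posPhi)) (K : Tw V) :
    actionBr A B K ∈ genBundle J .posPhi .posPhi K := by
  have hAK : ⁅A K, K.1⁆ = 0 := sub_eq_zero.2 (hA.2 K).2.symm
  have hBK : ⁅B K, K.1⁆ = 0 := sub_eq_zero.2 (hB.2 K).2.symm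
  have hbr : actionBr A B K = -⁅A K, B K⁆ := by simp [actionBr, dd, hAK, hBK]
  rw [hbr]
  exact neg_mem (lie_mem_genBundle (hA.2 K) (hB.2 K))

theorem lie_genProj_neg_one (K : Tw V) {C : V →L[ℝ] V} (hC : C ∈ skewEnd V) :
    ⁅genProj (-1) K.1 C, K.1⁆ = ⁅C, K.1⁆ := by
  rw [genProj_apply, skewProj_of_mem hC]
  simp only [Ring.lie_def, smul_mul_assoc, mul_smul_comm, sub_mul, mul_sub, mul_assoc,
    K.mul_self, K.mul_self_mul, mul_neg, mul_one]
  module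

end ActionBracket

section Bundles

variable {V : Type*} [NormedAddCommGroup V] [InnerProductSpace ℝ V] [FiniteDimensional ℝ V]
  [CompleteSpace V] {J : Tw V} {S : SType} {k : ℕ} {a : Fin (k + 1) → Tw V → ℝ}

theorem exists_isSkewAlgebroid_skewEnd (ha : ∀ i, IsSmooth (a i))
    (hda : ∀ i, ∀ C ∈ Gam fun _ : Tw V => skewEnd V, ∀ K,
      dd (a i) K (anchor (S.sec J) K (C K)) = 0) :
    ∃ br, IsSkewAlgebroid (fun _ => skewEnd V) br (anchor fun K => polyQ J a K * S.sec J K) :=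
  exists_isSkewAlgebroid_polyQ_mul_sec isBundleProj_skewProj isBundleProj_skewProj
    (fun _ => le_rfl) (fun _ => le_rfl) (fun K => conj_skewProj (.inl (star_polyQ J a K)))
    (fun K => conj_skewProj (star_polyQ_mul_sec J a S K))
    (fun _ hA _ hB K => by rw [skewProj_of_mem (actionBr_mem_skewEnd hA hB K)]) ha hda

theorem exists_isSkewAlgebroid_genBundle {γ δ : Gen} {σ : ℝ} (hσ : σ * σ = 1)
    (hδ : ∀ K, δ.sec J K = σ • γ.sec J K)
    (hδS : ∀ K, (δ.tilde S).sec J K = σ • (γ.tilde S).sec J K)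
    (hbr : ∀ A ∈ Gam (genBundle J γ δ), ∀ B ∈ Gam (genBundle J γ δ), ∀ K,
      ⁅genProj σ (γ.sec J K) (actionBr A B K), K.1⁆ = ⁅actionBr A B K, K.1⁆)
    (ha : ∀ i, IsSmooth (a i))
    (hda : ∀ i, ∀ C ∈ Gam (genBundle J (γ.tilde S) (δ.tilde S)), ∀ K,
      dd (a i) K (anchor (S.sec J) K (C K)) = 0) :
    ∃ br, IsSkewAlgebroid (genBundle J (γ.tilde S) (δ.tilde S)) br
      (anchor fun K => polyQ J a K * S.sec J K) :=
  exists_isSkewAlgebroid_polyQ_mul_sec (isBundleProj_genProj J hσ hδS)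
    (isBundleProj_genProj J hσ hδ) (fun _ _ h => h.1) (fun _ _ h => h.1)
    (fun K => conj_genProj (.inl (star_polyQ J a K)) ((γ.tilde S).commute_polyQ a).symm
      ((γ.tilde S).commute_polyQ a).symm σ)
    (fun K => conj_genProj (star_polyQ_mul_sec J a S K) (γ.tilde_semiconjBy a S)
      (γ.semiconjBy_tilde a S) σ)
    hbr ha hda

theorem exists_isSkewAlgebroid_genBundle_self {γ : Gen}
    (hbr : ∀ A ∈ Gam (genBundle J γ γ), ∀ B ∈ Gam (genBundle J γ γ), ∀ K,
      actionBr A B K ∈ genBundle J γ γ K)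
    (ha : ∀ i, IsSmooth (a i))
    (hda : ∀ i, ∀ C ∈ Gam (genBundle J (γ.tilde S) (γ.tilde S)), ∀ K,
      dd (a i) K (anchor (S.sec J) K (C K)) = 0) :
    ∃ br, IsSkewAlgebroid (genBundle J (γ.tilde S) (γ.tilde S)) br
      (anchor fun K => polyQ J a K * S.sec J K) :=
  exists_isSkewAlgebroid_genBundle (one_mul 1) (fun _ => (one_smul ℝ _).symm)
    (fun _ => (one_smul ℝ _).symm) (fun A hA B hB K => by
      rw [(isBundleProj_genProj_one J γ).fix K _ (hbr A hA B hB K)]) ha hda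

end Bundles

end Twistor

end

theorem theorem4p2 {V : Type*} [NormedAddCommGroup V] [InnerProductSpace ℝ V]
    [FiniteDimensional ℝ V] (hdim : 4 ≤ Module.finrank ℝ V)
    (J : Twistor.Tw V) (S : Twistor.SType) (E : Twistor.EType)
    (k : ℕ) (a : Fin (k + 1) → Twistor.Tw V → ℝ) (ha : ∀ i, Twistor.IsSmooth (a i))
    (hda : ∀ i, ∀ C ∈ Twistor.Gam (E.bundleS S J), ∀ K : Twistor.Tw V,
      Twistor.dd (a i) K (Twistor.anchor (S.sec J) K (C K)) = 0) :
    ∃ br : Twistor.Gam (E.bundleS S J) →ₗ[ℝ] Twistor.Gam (E.bundleS S J) →ₗ[ℝ]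
        Twistor.Gam (E.bundleS S J),
      Twistor.IsSkewAlgebroid (E.bundleS S J) br
        (Twistor.anchor fun K => Twistor.polyQ J a K * S.sec J K) := by
  have : CompleteSpace V := FiniteDimensional.complete ℝ V
  cases E with
  | o => exact Twistor.exists_isSkewAlgebroid_skewEnd ha hda
  | oPhi =>
    refine Twistor.exists_isSkewAlgebroid_genBundle (σ := -1) (by norm_num)
      (fun K => (neg_one_smul ℝ K.1).symm) (Twistor.Gen.tilde_negPhi_sec S J)
      (fun A hA B hB K => Twistor.lie_genProj_neg_one K ?_) ha hda
    exact Twistor.actionBr_mem_skewEnd ⟨hA.1, fun L => (hA.2 L).1⟩ ⟨hB.1, fun L => (hB.2 L).1⟩ K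
  | uJ =>
    exact Twistor.exists_isSkewAlgebroid_genBundle_self
      (fun A hA B hB K => Twistor.actionBr_mem_genBundle_posJ hA hB K) ha hda
  | uPhi =>
    exact Twistor.exists_isSkewAlgebroid_genBundle_self
      (fun A hA B hB K => Twistor.actionBr_mem_genBundle_posPhi hA hB K) ha hda
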